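/- All graphs are finite and simple, and $\log$ is the natural logarithm. Write $K_n^{(k)}$ for the graph obtained from the complete graph $K_n$ by subdividing each edge $k$ times (each edge becomes a path of length $k+1$). A trigraph on a vertex set $V$ is a partition of $V$ into nodes with two symmetric, irreflexive, mutually exclusive relations on the nodes, the black and the red adjacency. Contracting two distinct nodes $X,Y$ replaces them by the node $X\cup Y$; a remaining node $Z$ is joined to $X\cup Y$ by a black edge if it was joined to both $X$ and $Y$ by black edges, by a red edge if it was adjacent to at least one of $X,Y$ but not joined to both by black edges, and is not adjacent to $X\cup Y$ otherwise; all other adjacencies are unchanged. The twin-width $\mathrm{tww}(G)$ is the least $t$ such that, starting with the trigraph whose nodes are the singletons, whose black edges are the edges of $G$ and which has no red edges, one can reach a trigraph with a single node by successive contractions, every trigraph on the way having at most $t$ red neighbours at each node. For a positive integer $r$ and a linear order $L$ on $V(G)$, let $b_r(L,v)$ be the maximum number of paths of length at most $r$ in $G$ that start in $v$, pairwise share no vertex other than $v$, and end at vertices strictly before $v$ in $L$. The $r$-admissibility of $G$ is $\mathrm{adm}_r(G)=\min_L\max_{v} b_r(L,v)$. A function $f$ on $[0,\infty)$ is called triple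 exponential if there are real constants $a,a'>0$ and $b,b'$ with $2^{2^{2^{ac+b}}}\le f(c)\le 2^{2^{2^{a'c+b'}}}$ for all $c\ge 0$. **Statement.** There is a triple exponential function $f:[0,\infty)\to\mathbb R$ such that the following hold. 1. For every real $c>0$ and all integers $n\ge 1$ and $k\ge 0$ with $k\ge \frac{\log n}{c}$, $\mathrm{tww}(K_n^{(k)})\le f(c)$. 2. For all integers $d\ge 1$ and $r\ge 4$ there is a graph $G$ such that $G$ has no $K_{2,2}$ subgraph, $\mathrm{tww}(G)\le f(2\log d)$, and $\mathrm{adm}_r(G)\ge d^{2(r-1)}$. 3. Moreover, for all integers $d\ge 1$ and $r\ge 4$, with $n=d^{2(r-1)}$, the graph $K_n^{(r-1)}$ has no $K_{2,2}$ subgraph, $\mathrm{tww}(K_n^{(r-1)})\le f(2\log d)$, and $\mathrm{adm}_r(K_n^{(r-1)})\ge d^{2(r-1)}-1$. -/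

import Mathlib

open SimpleGraph

noncomputable section

/-- A trigraph on the vertex set `V`: the nodes form a partition of `V`, and the nodes carry two
mutually exclusive, symmetric, irreflexive relations, the black and the red adjacency. -/
structure Trigraph (V : Type) where
  nodes : Set (Set V)
  isPartition : Setoid.IsPartition nodes
  black : Set V → Set V → Prop
  red : Set V → Set V → Prop
  black_mem : ∀ X Y, black X Y → X ∈ nodes ∧ Y ∈ nodes
  red_mem : ∀ X Y, red X Y → X ∈ nodes ∧ Y ∈ nodes
  black_symm : ∀ X Y, black X Y → black Y X
  red_symm : ∀ X Y, red X Y → red Y X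
  black_irrefl : ∀ X, ¬ black X X
  red_irrefl : ∀ X, ¬ red X X
  exclusive : ∀ X Y, ¬ (black X Y ∧ red X Y)

namespace Trigraph

variable {V : Type}

/-- Adjacency by a black or a red edge. -/
def Adj (T : Trigraph V) (X Y : Set V) : Prop := T.black X Y ∨ T.red X Y

/-- `T` is a `d`-trigraph: every node has at most `d` red neighbours. -/
def MaxRedDegreeLE (T : Trigraph V) (d : ℕ) : Prop :=
  ∀ X ∈ T.nodes, {Y : Set V | T.red X Y}.ncard ≤ d

/-- `T` is the trigraph of singletons of `G`: its black edges are the edges of `G` and it has no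
red edge. -/
def IsInitial (T : Trigraph V) (G : SimpleGraph V) : Prop :=
  T.nodes = Set.range (fun v : V => ({v} : Set V)) ∧
  (∀ u v : V, T.black {u} {v} ↔ G.Adj u v) ∧
  (∀ X Y, ¬ T.red X Y)

/-- `T'` is obtained from `T` by contracting two distinct nodes `X` and `Y` into `X ∪ Y`. -/
def IsContraction (T T' : Trigraph V) : Prop :=
  ∃ X ∈ T.nodes, ∃ Y ∈ T.nodes, X ≠ Y ∧
    T'.nodes = (T.nodes \ {X, Y}) ∪ {X ∪ Y} ∧
    (∀ Z ∈ T.nodes \ {X, Y},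
      (T'.Adj (X ∪ Y) Z ↔ T.Adj X Z ∨ T.Adj Y Z) ∧
      (T'.black (X ∪ Y) Z ↔ T.black X Z ∧ T.black Y Z)) ∧
    (∀ Z ∈ T.nodes \ {X, Y}, ∀ W ∈ T.nodes \ {X, Y},
      (T'.black Z W ↔ T.black Z W) ∧ (T'.red Z W ↔ T.red Z W))

end Trigraph

/-- `G` has a `d`-contraction sequence `T n, …, T 1`, where `n` is the number of vertices. -/
def HasContractionSequence {V : Type} (G : SimpleGraph V) (d : ℕ) : Prop :=
  ∃ T : ℕ → Trigraph V,
    (T (Nat.card V)).IsInitial G ∧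
    (T 1).nodes = {Set.univ} ∧
    (∀ i, 1 ≤ i → i ≤ Nat.card V → (T i).MaxRedDegreeLE d) ∧
    (∀ i, 1 ≤ i → i < Nat.card V → (T (i + 1)).IsContraction (T i))

/-- The twin-width of a (finite, non-empty) graph. -/
def twinWidth {V : Type} (G : SimpleGraph V) : ℕ :=
  sInf {d : ℕ | HasContractionSequence G d}

/-- There are `m` paths of length at most `r` in `G` that start in `v`, pairwise share no vertex
other than `v`, and end at vertices that lie (strictly) before `v` in the order `L`. -/
def HasBackPaths {V : Type} (G : SimpleGraph V) (r : ℕ) (L : LinearOrder V) (v : V)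
    (m : ℕ) : Prop :=
  ∃ (u : Fin m → V) (p : ∀ i, G.Walk v (u i)),
    (∀ i, (p i).IsPath ∧ (p i).length ≤ r ∧ L.lt (u i) v) ∧
    (∀ i j, i ≠ j → ∀ w, w ∈ (p i).support → w ∈ (p j).support → w = v)

/-- The `r`-backconnectivity of `v` with respect to the order `L` (for a finite graph). -/
def backconnectivity {V : Type} (G : SimpleGraph V) (r : ℕ) (L : LinearOrder V) (v : V) : ℕ :=
  sSup {m : ℕ | HasBackPaths G r L v m}

/-- The `r`-admissibility of a (finite) graph. -/
def admissibility {V : Type} (G : SimpleGraph V) (r : ℕ) : ℕ :=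
  ⨅ L : LinearOrder V, ⨆ v : V, backconnectivity G r L v

/-- The edges of the complete graph on `Fin n`, each given by its increasing pair of ends. -/
abbrev CliqueEdge (n : ℕ) : Type := {p : Fin n × Fin n // p.1 < p.2}

/-- The vertices of the `k`-subdivision of `K_n`: the `n` original vertices, and `k` subdivision
vertices for each edge. -/
abbrev SubdividedCliqueVertex (n k : ℕ) : Type := Fin n ⊕ (CliqueEdge n × Fin k)

/-- The vertex at position `j` (`0 ≤ j ≤ k + 1`) on the path that replaces the edge `e`: the smaller
end of `e`, then the `k` subdivision vertices of `e`, then the larger end of `e`. -/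
def cliquePathVertex {n k : ℕ} (e : CliqueEdge n) (j : ℕ) : SubdividedCliqueVertex n k :=
  if j = 0 then Sum.inl e.1.1
  else if h : j - 1 < k then Sum.inr (e, ⟨j - 1, h⟩)
  else Sum.inl e.1.2

/-- The complete graph `K_n` with each edge subdivided `k` times (a path of length `k + 1`). -/
def subdividedClique (n k : ℕ) : SimpleGraph (SubdividedCliqueVertex n k) :=
  SimpleGraph.fromRel fun x y =>
    ∃ (e : CliqueEdge n) (j : ℕ), j ≤ k ∧ x = cliquePathVertex e j ∧ y = cliquePathVertex e (j + 1)

/-- `f`, as a function on `[0, ∞)`, is triple exponential: it lies between two functions of the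
form `2 ^ 2 ^ 2 ^ (a * c + b)` with `a > 0`. -/
def IsTripleExponential (f : ℝ → ℝ) : Prop :=
  ∃ a b a' b' : ℝ, 0 < a ∧ 0 < a' ∧ ∀ c : ℝ, 0 ≤ c →
    (2 : ℝ) ^ ((2 : ℝ) ^ ((2 : ℝ) ^ (a * c + b))) ≤ f c ∧
    f c ≤ (2 : ℝ) ^ ((2 : ℝ) ^ ((2 : ℝ) ^ (a' * c + b')))

end

-- The core is a bound polynomial in `B`: if `n ≤ B ^ k`, then `K_n^{(k)}` has twin-width at most
-- `100 * (B + 2) ^ 4`. Taking `B = ⌈exp c⌉` covers `k ≥ log n / c`, and such a bound is far below a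
-- triple exponential one.
--
-- Write the names of the branch vertices with `k` digits in base `B`. A subdivision vertex of the
-- edge `uv` carries its position and prefixes of `u` and `v`, and it may forget one further digit
-- of a name for every step away from the corresponding end. Forgetting these digits merges the
-- paths leaving a branch vertex into a trie, so that branch vertices, at first with large degree
-- but only black edges, end up adjacent to boundedly many classes. Then the last digits of all
-- names are deleted level by level until only positions remain; these form a cycle, which is
-- contracted last. At each stage a class has `O(B ^ 2)` red neighbours
-- (`subdivisionLabel_mem_neighbourLabels`), and one stage splits into `O(B ^ 2)` classes of the
-- stage before (`subdivisionLabel_mem_previousLabels`). Performing the merges of a stage one at a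
-- time therefore costs only the product of the two bounds (`hasContractionSequence_of_labels`).
--
-- For the admissibility, the last branch vertex in any order reaches all other branch vertices by
-- internally disjoint paths of length `k + 1 = r`.

-- Quotient trigraphs and merging of classes

namespace Trigraph

/-- The quotient trigraph of `G` by an equivalence relation: two classes are joined by a black edge
if they are completely adjacent, and by a red edge if they are adjacent but not completely. -/
def ofSetoid {V : Type} (G : SimpleGraph V) (r : Setoid V) : Trigraph V where
  nodes := r.classes
  isPartition := Setoid.isPartition_classes r
  black X Y := X ∈ r.classes ∧ Y ∈ r.classes ∧ X ≠ Y ∧ ∀ x ∈ X, ∀ y ∈ Y, G.Adj x y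
  red X Y := X ∈ r.classes ∧ Y ∈ r.classes ∧ X ≠ Y ∧ (∃ x ∈ X, ∃ y ∈ Y, G.Adj x y) ∧
    ¬ ∀ x ∈ X, ∀ y ∈ Y, G.Adj x y
  black_mem _ _ h := ⟨h.1, h.2.1⟩
  red_mem _ _ h := ⟨h.1, h.2.1⟩
  black_symm _ _ h := ⟨h.2.1, h.1, h.2.2.1.symm, fun x hx y hy => (h.2.2.2 y hy x hx).symm⟩
  red_symm := by
    rintro X Y ⟨hX, hY, hne, ⟨x, hx, y, hy, h⟩, hn⟩
    exact ⟨hY, hX, hne.symm, ⟨y, hy, x, hx, h.symm⟩,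
      fun h' => hn fun a ha b hb => (h' b hb a ha).symm⟩
  black_irrefl _ h := h.2.2.1 rfl
  red_irrefl _ h := h.2.2.1 rfl
  exclusive _ _ h := h.2.2.2.2.2 h.1.2.2.2

end Trigraph

/-- The equivalence relation obtained from `r` by uniting the classes of `x` and `y`. -/
def Setoid.mergeClasses {V : Type} (r : Setoid V) (x y : V) : Setoid V where
  r a b := r a b ∨ ((r a x ∨ r a y) ∧ (r b x ∨ r b y))
  iseqv := by
    refine ⟨fun a => Or.inl (r.refl a), ?_, ?_⟩
    · rintro a b (h | h)
      · exact Or.inl (r.symm h)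
      · exact Or.inr h.symm
    · rintro a b c (h | h) (h' | h')
      · exact Or.inl (r.trans h h')
      · exact Or.inr ⟨h'.1.imp (r.trans h) (r.trans h), h'.2⟩
      · exact Or.inr ⟨h.1, h.2.imp (r.trans (r.symm h')) (r.trans (r.symm h'))⟩
      · exact Or.inr ⟨h.1, h'.2⟩

theorem Setoid.mergeClasses_rel {V : Type} (r : Setoid V) (x y a b : V) :
    r.mergeClasses x y a b ↔ r a b ∨ ((r a x ∨ r a y) ∧ (r b x ∨ r b y)) := Iff.rfl

theorem Setoid.le_mergeClasses {V : Type} (r : Setoid V) (x y : V) : r ≤ r.mergeClasses x y :=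
  fun _ _ h => Or.inl h

theorem Setoid.mergeClasses_le {V : Type} {r s : Setoid V} {x y : V} (h : r ≤ s) (hxy : s x y) :
    r.mergeClasses x y ≤ s := by
  rintro a b (hab | ⟨ha | ha, hb | hb⟩)
  · exact h hab
  · exact s.trans (h ha) (s.symm (h hb))
  · exact s.trans (s.trans (h ha) hxy) (s.symm (h hb))
  · exact s.trans (s.trans (h ha) (s.symm hxy)) (s.symm (h hb))
  · exact s.trans (h ha) (s.symm (h hb))

theorem Setoid.setOf_rel_eq_iff {V : Type} (r : Setoid V) (x y : V) :
    {z | r z x} = {z | r z y} ↔ r x y := by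
  constructor
  · intro h
    have : x ∈ {z | r z x} := r.refl x
    rw [h] at this
    exact this
  · intro h
    ext z
    exact ⟨fun hz => r.trans hz h, fun hz => r.trans hz (r.symm h)⟩

theorem Setoid.classes_mergeClasses {V : Type} (r : Setoid V) (x y : V) :
    (r.mergeClasses x y).classes =
      (r.classes \ {{z | r z x}, {z | r z y}}) ∪ {{z | r z x} ∪ {z | r z y}} := by
  ext s
  constructor
  · rintro ⟨w, rfl⟩
    by_cases hw : r w x ∨ r w y
    · right
      ext z
      simp only [Set.mem_ofPred_eq, Set.mem_union, Setoid.mergeClasses_rel]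
      constructor
      · rintro (h | h)
        · exact hw.imp (r.trans h) (r.trans h)
        · exact h.1
      · exact fun h => Or.inr ⟨h, hw⟩
    · left
      have hs : {z | r.mergeClasses x y z w} = {z | r z w} := by
        ext z
        simp only [Set.mem_ofPred_eq, Setoid.mergeClasses_rel]
        tauto
      rw [hs]
      refine ⟨⟨w, rfl⟩, ?_⟩
      rintro (h | h)
      · exact hw (Or.inl ((r.setOf_rel_eq_iff w x).1 h))
      · exact hw (Or.inr ((r.setOf_rel_eq_iff w y).1 h))
  · rintro (⟨⟨w, rfl⟩, hw⟩ | rfl)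
    · refine ⟨w, ?_⟩
      have h1 : ¬ r w x := fun h => hw (Or.inl ((r.setOf_rel_eq_iff w x).2 h))
      have h2 : ¬ r w y := fun h => hw (Or.inr ((r.setOf_rel_eq_iff w y).2 h))
      ext z
      simp only [Set.mem_ofPred_eq, Setoid.mergeClasses_rel]
      tauto
    · refine ⟨x, ?_⟩
      ext z
      simp only [Set.mem_ofPred_eq, Set.mem_union, Setoid.mergeClasses_rel]
      have := r.refl x
      tauto

theorem Setoid.union_notMem_classes {V : Type} (r : Setoid V) {x y : V} (h : ¬ r x y) :
    {z | r z x} ∪ {z | r z y} ∉ r.classes := by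
  rintro ⟨w, hw⟩
  have hx : x ∈ {z | r z w} := hw ▸ Or.inl (r.refl x)
  have hy : y ∈ {z | r z w} := hw ▸ Or.inr (r.refl y)
  exact h (r.trans hx (r.symm hy))

theorem Setoid.ncard_classes_mergeClasses {V : Type} [Finite V] (r : Setoid V) {x y : V}
    (h : ¬ r x y) : (r.mergeClasses x y).classes.ncard + 1 = r.classes.ncard := by
  have hne : ({z | r z x} : Set V) ≠ {z | r z y} := fun h' => h ((r.setOf_rel_eq_iff x y).1 h')
  have hsub : ({{z | r z x}, {z | r z y}} : Set (Set V)) ⊆ r.classes := by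
    rintro s (rfl | rfl)
    · exact ⟨x, rfl⟩
    · exact ⟨y, rfl⟩
  have hnot : {z | r z x} ∪ {z | r z y} ∉ r.classes \ {{z | r z x}, {z | r z y}} :=
    fun h' => r.union_notMem_classes h h'.1
  rw [Setoid.classes_mergeClasses, Set.union_singleton, Set.ncard_insert_of_notMem hnot]
  have := Set.ncard_sdiff_add_ncard_of_subset hsub
  rw [Set.ncard_pair hne] at this
  omega

namespace Trigraph

variable {V : Type} (G : SimpleGraph V)

theorem ofSetoid_adj_iff (r : Setoid V) (X Y : Set V) :
    (ofSetoid G r).Adj X Y ↔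
      X ∈ r.classes ∧ Y ∈ r.classes ∧ X ≠ Y ∧ ∃ x ∈ X, ∃ y ∈ Y, G.Adj x y := by
  constructor
  · rintro (⟨⟨x, rfl⟩, ⟨y, rfl⟩, hne, h⟩ | ⟨hX, hY, hne, h, -⟩)
    · exact ⟨⟨x, rfl⟩, ⟨y, rfl⟩, hne, x, r.refl x, y, r.refl y, h x (r.refl x) y (r.refl y)⟩
    · exact ⟨hX, hY, hne, h⟩
  · rintro ⟨hX, hY, hne, h⟩
    by_cases hall : ∀ x ∈ X, ∀ y ∈ Y, G.Adj x y
    · exact Or.inl ⟨hX, hY, hne, hall⟩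
    · exact Or.inr ⟨hX, hY, hne, h, hall⟩

theorem isInitial_ofSetoid_bot : (ofSetoid G ⊥).IsInitial G := by
  have hs : ∀ v : V, {z | (⊥ : Setoid V) z v} = {v} := fun v => by
    ext z; simp
  have hm : ∀ v : V, {v} ∈ (⊥ : Setoid V).classes := fun v => ⟨v, (hs v).symm⟩
  refine ⟨?_, ?_, ?_⟩
  · ext s
    constructor
    · rintro ⟨v, rfl⟩
      exact ⟨v, (hs v).symm⟩
    · rintro ⟨v, rfl⟩
      exact hm v
  · intro u v
    constructor
    · exact fun h => h.2.2.2 u rfl v rfl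
    · intro h
      refine ⟨hm u, hm v, fun h' => h.ne (Set.singleton_injective h'), ?_⟩
      rintro _ rfl _ rfl
      exact h
  · rintro _ _ ⟨⟨u, rfl⟩, ⟨v, rfl⟩, -, ⟨x, hx, y, hy, h⟩, hn⟩
    rw [hs] at hx hn
    rw [hs] at hy hn
    apply hn
    rintro _ rfl _ rfl
    rw [Set.mem_singleton_iff] at hx hy
    exact hx ▸ hy ▸ h

/-- The colours in the quotient depend only on the partition, not on the order of contractions: a
class is completely adjacent to a union iff it is so to both parts, and adjacent to it iff it is
adjacent to one of them. Hence only partitions need to be tracked. -/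
theorem isContraction_mergeClasses (r : Setoid V) {x y : V} (h : ¬ r x y) :
    (ofSetoid G r).IsContraction (ofSetoid G (r.mergeClasses x y)) := by
  have hX : {z | r z x} ∈ r.classes := ⟨x, rfl⟩
  have hY : {z | r z y} ∈ r.classes := ⟨y, rfl⟩
  have hc := r.classes_mergeClasses x y
  have hu := r.union_notMem_classes h
  have hmem : ∀ Z ∈ r.classes \ {{z | r z x}, {z | r z y}},
      Z ∈ (r.mergeClasses x y).classes := fun Z hZ => hc ▸ Or.inl hZ
  have hmemU : {z | r z x} ∪ {z | r z y} ∈ (r.mergeClasses x y).classes := hc ▸ Or.inr rfl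
  refine ⟨_, hX, _, hY, fun h' => h ((r.setOf_rel_eq_iff x y).1 h'), hc, ?_, ?_⟩
  · intro Z hZ
    have hZ1 : Z ∈ r.classes := hZ.1
    have hZX : {z | r z x} ≠ Z := fun h' => hZ.2 (Or.inl h'.symm)
    have hZY : {z | r z y} ≠ Z := fun h' => hZ.2 (Or.inr h'.symm)
    have hZU : {z | r z x} ∪ {z | r z y} ≠ Z := fun h' => hu (h' ▸ hZ1)
    have hZm := hmem Z hZ
    constructor
    · simp only [ofSetoid_adj_iff]
      constructor
      · rintro ⟨-, -, -, a, ha | ha, b, hb, hab⟩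
        · exact Or.inl ⟨hX, hZ1, hZX, a, ha, b, hb, hab⟩
        · exact Or.inr ⟨hY, hZ1, hZY, a, ha, b, hb, hab⟩
      · rintro (⟨-, -, -, a, ha, b, hb, hab⟩ | ⟨-, -, -, a, ha, b, hb, hab⟩)
        · exact ⟨hmemU, hZm, hZU, a, Or.inl ha, b, hb, hab⟩
        · exact ⟨hmemU, hZm, hZU, a, Or.inr ha, b, hb, hab⟩
    · constructor
      · rintro ⟨-, -, -, hall⟩
        exact ⟨⟨hX, hZ1, hZX, fun a ha => hall a (Or.inl ha)⟩,
          ⟨hY, hZ1, hZY, fun a ha => hall a (Or.inr ha)⟩⟩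
      · rintro ⟨⟨-, -, -, h1⟩, ⟨-, -, -, h2⟩⟩
        exact ⟨hmemU, hZm, hZU, fun a ha => ha.elim (h1 a) (h2 a)⟩
  · intro Z hZ W hW
    have hZm := hmem Z hZ
    have hWm := hmem W hW
    exact ⟨⟨fun h' => ⟨hZ.1, hW.1, h'.2.2⟩, fun h' => ⟨hZm, hWm, h'.2.2⟩⟩,
      ⟨fun h' => ⟨hZ.1, hW.1, h'.2.2⟩, fun h' => ⟨hZm, hWm, h'.2.2⟩⟩⟩

-- From chains of partitions to contraction sequences

/-- Passing through finer equivalence relations: if every class of `s` splits into classes of `r`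
of which at most `M` occur, and `s` has red degree at most `d`, then every equivalence relation
between `r` and `s` has red degree at most `M * (d + 1)`. The classes are given by labels. -/
theorem maxRedDegreeLE_of_between {L : Type*} [DecidableEq L] (l l' : V → L) {M d : ℕ}
    (hM : ∀ x, ∃ S : Finset L, S.card ≤ M ∧ ∀ y, l' y = l' x → l y ∈ S)
    (hd : ∀ x, ∃ S : Finset L, S.card ≤ d ∧ ∀ a y b c e, l' a = l' x → l' b = l' y → G.Adj a b →
      l' c = l' x → l' e = l' y → ¬ G.Adj c e → l' y ∈ S)
    {r : Setoid V} (h1 : ∀ x y, l x = l y → r x y) (h2 : ∀ x y, r x y → l' x = l' y) :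
    (ofSetoid G r).MaxRedDegreeLE (M * (d + 1)) := by
  classical
  rintro _ ⟨x, rfl⟩
  choose S hSc hS using hM
  obtain ⟨D, hDc, hD⟩ := hd x
  let fib : L → Finset L := fun p => if h : ∃ z, l' z = p then S h.choose else ∅
  have hfc : ∀ p, (fib p).card ≤ M := by
    intro p
    simp only [fib]
    split_ifs with h
    · exact hSc _
    · simp
  have hf : ∀ y, l y ∈ fib (l' y) := by
    intro y
    have h : ∃ z, l' z = l' y := ⟨y, rfl⟩
    simp only [fib, dif_pos h]
    exact hS _ _ h.choose_spec.symm
  -- A red neighbour may also lie in the same coarse class, which accounts for the `+ 1`.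
  let T : Finset L := (insert (l' x) D).biUnion fib
  have hTc : T.card ≤ M * (d + 1) := by
    calc T.card ≤ (insert (l' x) D).card * M := Finset.card_biUnion_le_card_mul _ _ _ fun p _ => hfc p
      _ ≤ (d + 1) * M := Nat.mul_le_mul_right _ ((Finset.card_insert_le _ _).trans (by omega))
      _ = M * (d + 1) := Nat.mul_comm _ _
  -- Every class of `r` is a union of fine classes, so any one of its fine labels determines it.
  let cl : L → Set V := fun p => if h : ∃ z, l z = p then {w | r w h.choose} else ∅
  have hsub : {Y : Set V | (ofSetoid G r).red {z | r z x} Y} ⊆ cl '' (T : Set L) := by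
    rintro _ ⟨-, ⟨y, rfl⟩, -, ⟨a, ha, b, hb, hab⟩, hn⟩
    push Not at hn
    obtain ⟨c, hc, e, he, hce⟩ := hn
    refine ⟨l y, ?_, ?_⟩
    · simp only [T, Finset.coe_biUnion, Set.mem_iUnion]
      refine ⟨l' y, ?_, hf y⟩
      exact Finset.mem_coe.2 (Finset.mem_insert_of_mem
        (hD a y b c e (h2 _ _ ha) (h2 _ _ hb) hab (h2 _ _ hc) (h2 _ _ he) hce))
    · have h : ∃ z, l z = l y := ⟨y, rfl⟩
      simp only [cl, dif_pos h]
      exact (r.setOf_rel_eq_iff _ _).2 (h1 _ _ h.choose_spec)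
  calc _ ≤ (cl '' (T : Set L)).ncard := Set.ncard_le_ncard hsub (T.finite_toSet.image _)
    _ ≤ (T : Set L).ncard := Set.ncard_image_le T.finite_toSet
    _ = T.card := Set.ncard_coe_finset T
    _ ≤ _ := hTc

end Trigraph

/-- A chain of label functions, from an injective one to a constant one, in which consecutive labels
determine each other up to `M` possibilities and every quotient has red degree at most `d`, gives a
contraction sequence. -/
theorem hasContractionSequence_of_labels {V L : Type} [Finite V] [Nonempty V] [DecidableEq L]
    (G : SimpleGraph V) (l : ℕ → V → L) (N M d : ℕ)
    (h0 : Function.Injective (l 0)) (hN : ∀ x y, l N x = l N y)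
    (hmono : ∀ m x y, l m x = l m y → l (m + 1) x = l (m + 1) y)
    (hM : ∀ m x, ∃ S : Finset L, S.card ≤ M ∧ ∀ y, l (m + 1) y = l (m + 1) x → l m y ∈ S)
    (hd : ∀ m x, ∃ S : Finset L, S.card ≤ d ∧ ∀ a y b c e, l m a = l m x → l m b = l m y →
      G.Adj a b → l m c = l m x → l m e = l m y → ¬ G.Adj c e → l m y ∈ S) :
    HasContractionSequence G (M * (d + 1)) := by
  have hmono' : ∀ {m m'}, m ≤ m' → Setoid.ker (l m) ≤ Setoid.ker (l m') := by
    intro m m' h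
    induction h with
    | refl => exact le_rfl
    | step _ ih => exact ih.trans fun x y h => hmono _ x y h
  have hbot : Setoid.ker (l 0) = ⊥ := by
    rw [eq_bot_iff]
    intro x y h
    exact h0 h
  have htop : Setoid.ker (l N) = ⊤ := by
    rw [eq_top_iff]
    exact fun x y _ => hN x y
  have htopc : (⊤ : Setoid V).classes = {Set.univ} := by
    ext s
    constructor
    · rintro ⟨y, rfl⟩
      ext z
      simp [Setoid.top_def]
    · rintro rfl
      refine ⟨Classical.arbitrary V, ?_⟩
      ext z
      simp [Setoid.top_def]
  have key : ∀ q (r : Setoid V), r.classes.ncard = q →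
      (∀ m, Setoid.ker (l m) ≤ r ∨ r ≤ Setoid.ker (l m)) →
      ∃ T : ℕ → Setoid V, T q = r ∧ T 1 = ⊤ ∧
        (∀ i, 1 ≤ i → i ≤ q → (Trigraph.ofSetoid G (T i)).MaxRedDegreeLE (M * (d + 1))) ∧
        (∀ i, 1 ≤ i → i < q →
          (Trigraph.ofSetoid G (T (i + 1))).IsContraction (Trigraph.ofSetoid G (T i))) := by
    intro q
    induction q with
    | zero =>
      intro r hr _
      have hfin : r.classes.Finite := Set.toFinite _
      rw [Set.ncard_eq_zero hfin] at hr
      have : {z | r z (Classical.arbitrary V)} ∈ r.classes := ⟨_, rfl⟩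
      rw [hr] at this
      exact this.elim
    | succ q ih =>
      intro r hr hcomp
      by_cases hrt : r = ⊤
      · subst hrt
        rw [htopc, Set.ncard_singleton] at hr
        obtain rfl : q = 0 := by omega
        refine ⟨fun _ => ⊤, rfl, rfl, ?_, fun i h1 h2 => by omega⟩
        rintro i - - X hX
        have : {Y : Set V | (Trigraph.ofSetoid G ⊤).red X Y} = ∅ := by
          ext Y
          simp only [Set.mem_ofPred_eq, Set.mem_empty_iff_false, iff_false]
          rintro ⟨hX, hY, hne, -⟩
          rw [htopc] at hX hY
          exact hne (hX.trans hY.symm)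
        rw [this, Set.ncard_empty]
        exact Nat.zero_le _
      · classical
        have hex : ∃ m, ¬ Setoid.ker (l m) ≤ r :=
          ⟨N, fun h => hrt (top_le_iff.1 (htop ▸ h))⟩
        -- The last stage before the first one not finer than `r`; by comparability `r` lies between
        -- the stages `m` and `m + 1`, and merging inside a class of stage `m + 1` keeps it
        -- comparable with all stages.
        obtain ⟨m, hm, hmin⟩ : ∃ m, ¬ Setoid.ker (l (m + 1)) ≤ r ∧ Setoid.ker (l m) ≤ r := by
          have hs := Nat.find_spec hex
          have hlt : ∀ j < Nat.find hex, Setoid.ker (l j) ≤ r := fun j hj => by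
            simpa using Nat.find_min hex hj
          rcases hz : Nat.find hex with _ | m
          · rw [hz, hbot] at hs
            exact (hs bot_le).elim
          · rw [hz] at hs hlt
            exact ⟨m, hs, hlt m (Nat.lt_succ_self m)⟩
        have hle : r ≤ Setoid.ker (l (m + 1)) := (hcomp (m + 1)).resolve_left hm
        have hdeg : (Trigraph.ofSetoid G r).MaxRedDegreeLE (M * (d + 1)) :=
          Trigraph.maxRedDegreeLE_of_between G (l m) (l (m + 1)) (hM m) (hd (m + 1))
            (fun x y h => hmin h) (fun x y h => hle h)
        obtain ⟨x, y, hxy, hnxy⟩ : ∃ x y, Setoid.ker (l (m + 1)) x y ∧ ¬ r x y := by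
          by_contra! h
          exact hm fun x y => h x y
        have hcard := r.ncard_classes_mergeClasses hnxy
        obtain ⟨T, hTq, hT1, hTd, hTc⟩ := ih (r.mergeClasses x y) (by omega) (by
          intro j
          rcases Nat.lt_or_ge m j with hj | hj
          · exact Or.inr ((Setoid.mergeClasses_le hle hxy).trans (hmono' hj))
          · exact Or.inl (((hmono' hj).trans hmin).trans (r.le_mergeClasses x y)))
        -- Ensures that the update at `q + 1` does not overwrite `T 1`.
        have hq : q ≠ 0 := by
          rintro rfl
          have hfin : (r.mergeClasses x y).classes.Finite := Set.toFinite _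
          have h0 : (r.mergeClasses x y).classes.ncard = 0 := by omega
          rw [Set.ncard_eq_zero hfin] at h0
          have : {z | r.mergeClasses x y z x} ∈ (r.mergeClasses x y).classes := ⟨_, rfl⟩
          rw [h0] at this
          exact this.elim
        refine ⟨Function.update T (q + 1) r, by simp, ?_, ?_, ?_⟩
        · rw [Function.update_of_ne (by omega), hT1]
        · intro i h1 h2
          rcases Nat.lt_or_ge q i with hi | hi
          · obtain rfl : i = q + 1 := by omega
            rwa [Function.update_self]
          · rw [Function.update_of_ne (by omega)]
            exact hTd i h1 hi
        · intro i h1 h2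
          rw [Function.update_of_ne (show i ≠ q + 1 by omega)]
          rcases Nat.lt_or_ge i q with hi | hi
          · rw [Function.update_of_ne (by omega)]
            exact hTc i h1 hi
          · obtain rfl : i = q := by omega
            rw [Function.update_self, hTq]
            exact Trigraph.isContraction_mergeClasses G r hnxy
  have hcb : (⊥ : Setoid V).classes.ncard = Nat.card V := by
    have h := (Trigraph.isInitial_ofSetoid_bot G).1
    change (⊥ : Setoid V).classes = _ at h
    rw [h, ← Set.image_univ, Set.ncard_image_of_injective _ Set.singleton_injective,
      Set.ncard_univ]
  obtain ⟨T, hTq, hT1, hTd, hTc⟩ := key _ ⊥ hcb fun m => Or.inr bot_le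
  refine ⟨fun i => Trigraph.ofSetoid G (T i), ?_, ?_, hTd, hTc⟩
  · change (Trigraph.ofSetoid G (T _)).IsInitial G
    rw [hTq]
    exact Trigraph.isInitial_ofSetoid_bot G
  · change (T 1).classes = _
    rw [hT1, htopc]

-- Adjacency in the subdivided clique

section SubdividedClique

variable {n k : ℕ}

theorem cliquePathVertex_zero (e : CliqueEdge n) :
    (cliquePathVertex e 0 : SubdividedCliqueVertex n k) = Sum.inl e.1.1 := rfl

theorem cliquePathVertex_succ (e : CliqueEdge n) (i : Fin k) :
    cliquePathVertex e (i + 1) = Sum.inr (e, i) := by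
  simp [cliquePathVertex]

theorem cliquePathVertex_last (e : CliqueEdge n) :
    (cliquePathVertex e (k + 1) : SubdividedCliqueVertex n k) = Sum.inl e.1.2 := by
  simp [cliquePathVertex]

theorem cliquePathVertex_injOn (e : CliqueEdge n) {i j : ℕ} (hi : i ≤ k + 1) (hj : j ≤ k + 1)
    (h : (cliquePathVertex e i : SubdividedCliqueVertex n k) = cliquePathVertex e j) : i = j := by
  have hne : e.1.1 ≠ e.1.2 := e.2.ne
  unfold cliquePathVertex at h
  split_ifs at h <;> simp_all <;> omega

theorem subdividedClique_adj_succ (e : CliqueEdge n) {j : ℕ} (hj : j ≤ k) :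
    (subdividedClique n k).Adj (cliquePathVertex e j) (cliquePathVertex e (j + 1)) := by
  refine (SimpleGraph.fromRel_adj _ _ _).2 ⟨fun h => ?_, Or.inl ⟨e, j, hj, rfl, rfl⟩⟩
  have := cliquePathVertex_injOn e (by omega) (by omega) h
  omega

theorem subdividedClique_adj_first (e : CliqueEdge n) {i : Fin k} (hi : (i : ℕ) = 0) :
    (subdividedClique n k).Adj (Sum.inl e.1.1) (Sum.inr (e, i)) := by
  have h := subdividedClique_adj_succ (k := k) e (Nat.zero_le k)
  rwa [cliquePathVertex_zero, ← hi, cliquePathVertex_succ] at h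

theorem subdividedClique_adj_last (e : CliqueEdge n) {i : Fin k} (hi : (i : ℕ) + 1 = k) :
    (subdividedClique n k).Adj (Sum.inl e.1.2) (Sum.inr (e, i)) := by
  have h := subdividedClique_adj_succ (k := k) e le_rfl
  rw [cliquePathVertex_last] at h
  have h2 := cliquePathVertex_succ e i
  rw [hi] at h2
  rw [h2] at h
  exact h.symm

/-- `b` follows `a` on the path that replaces some edge. -/
inductive SubdivisionStep : SubdividedCliqueVertex n k → SubdividedCliqueVertex n k → Prop
  | first (e : CliqueEdge n) (i : Fin k) (hi : (i : ℕ) = 0) :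
      SubdivisionStep (Sum.inl e.1.1) (Sum.inr (e, i))
  | mid (e : CliqueEdge n) (i j : Fin k) (hij : (j : ℕ) = i + 1) :
      SubdivisionStep (Sum.inr (e, i)) (Sum.inr (e, j))
  | last (e : CliqueEdge n) (i : Fin k) (hi : (i : ℕ) + 1 = k) :
      SubdivisionStep (Sum.inr (e, i)) (Sum.inl e.1.2)

theorem subdivisionStep_cliquePathVertex (hk : 1 ≤ k) (e : CliqueEdge n) {j : ℕ} (hj : j ≤ k) :
    SubdivisionStep (k := k) (cliquePathVertex e j) (cliquePathVertex e (j + 1)) := by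
  rcases j with _ | j
  · rw [cliquePathVertex_zero, cliquePathVertex_succ e ⟨0, hk⟩]
    exact .first e _ rfl
  · rw [cliquePathVertex_succ e ⟨j, hj⟩]
    rcases hj.lt_or_eq with h | h
    · rw [cliquePathVertex_succ e ⟨j + 1, h⟩]
      exact .mid e _ _ rfl
    · subst h
      rw [cliquePathVertex_last]
      exact .last e _ rfl

theorem subdivisionStep_of_adj (hk : 1 ≤ k) {a b : SubdividedCliqueVertex n k}
    (h : (subdividedClique n k).Adj a b) : SubdivisionStep a b ∨ SubdivisionStep b a := by
  rcases ((SimpleGraph.fromRel_adj _ _ _).1 h).2 with ⟨e, j, hj, rfl, rfl⟩ | ⟨e, j, hj, rfl, rfl⟩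
  · exact Or.inl (subdivisionStep_cliquePathVertex hk e hj)
  · exact Or.inr (subdivisionStep_cliquePathVertex hk e hj)

/-- Disposes of `k = 0`, where `n ≤ 1` leaves no edges. -/
theorem one_le_of_subdividedClique_adj {B : ℕ} (hn : n ≤ B ^ k) {a b : SubdividedCliqueVertex n k}
    (h : (subdividedClique n k).Adj a b) : 1 ≤ k := by
  rcases Nat.eq_zero_or_pos k with rfl | hk
  · rw [pow_zero] at hn
    rcases ((SimpleGraph.fromRel_adj _ _ _).1 h).2 with ⟨e, -⟩ | ⟨e, -⟩ <;>
    · have h1 := e.2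
      have h2 := e.1.2.2
      rw [Fin.lt_def] at h1
      omega
  · exact hk

end SubdividedClique

-- Labels by prefixes in base `B`

/-- The numbers that arise from `p` by keeping it, deleting its last digit in base `B`, or appending
a digit. -/
def nearbyPrefixes (B p : ℕ) : Finset ℕ :=
  insert p (insert (p / B) ((Finset.range B).image fun w => p * B + w))

theorem card_nearbyPrefixes_le (B p : ℕ) : (nearbyPrefixes B p).card ≤ B + 2 := by
  have h1 : ((Finset.range B).image fun w => p * B + w).card ≤ B :=
    Finset.card_image_le.trans (Finset.card_range B).le
  unfold nearbyPrefixes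
  grw [Finset.card_insert_le, Finset.card_insert_le, h1]

theorem self_mem_nearbyPrefixes (B p : ℕ) : p ∈ nearbyPrefixes B p := Finset.mem_insert_self _ _

theorem div_pow_mem_nearbyPrefixes {B : ℕ} (hB : 1 ≤ B) (z : ℕ) {s t : ℕ} (h1 : s ≤ t + 1)
    (h2 : t ≤ s + 1) : z / B ^ s ∈ nearbyPrefixes B (z / B ^ t) := by
  unfold nearbyPrefixes
  simp only [Finset.mem_insert, Finset.mem_image, Finset.mem_range]
  obtain rfl | rfl | rfl : s = t ∨ s = t + 1 ∨ t = s + 1 := by omega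
  · exact Or.inl rfl
  · right; left
    rw [pow_succ, Nat.div_div_eq_div_mul]
  · right; right
    refine ⟨z / B ^ s % B, Nat.mod_lt _ hB, ?_⟩
    rw [pow_succ, ← Nat.div_div_eq_div_mul]
    exact Nat.div_add_mod' _ _

theorem div_pow_eq_zero_of_lt {B k z s : ℕ} (hB : 1 ≤ B) (hz : z < B ^ k) (hs : k ≤ s) :
    z / B ^ s = 0 :=
  Nat.div_eq_of_lt (hz.trans_le (Nat.pow_le_pow_right hB hs))

theorem div_pow_mem_nearbyPrefixes_zero {B k z s : ℕ} (hB : 1 ≤ B) (hz : z < B ^ k)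
    (hs : k ≤ s + 1) : z / B ^ s ∈ nearbyPrefixes B 0 := by
  have h := div_pow_mem_nearbyPrefixes hB z (s := s) (t := s + 1) (by omega) le_rfl
  rwa [div_pow_eq_zero_of_lt hB hz hs] at h

theorem div_pow_eq_div_pow_of_le {B x y s t : ℕ} (h : x / B ^ s = y / B ^ s) (hst : s ≤ t) :
    x / B ^ t = y / B ^ t := by
  obtain ⟨c, rfl⟩ := Nat.exists_eq_add_of_le hst
  rw [pow_add, ← Nat.div_div_eq_div_mul, ← Nat.div_div_eq_div_mul, h]

/-- How many of the `k` digits of the name of an end of an edge are dropped after `m` steps at a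
subdivision vertex at distance `k + 1 - t` from that end. -/
def droppedDigits (k m t : ℕ) : ℕ := max (m - k) (min m (k - t))

/-- The label after `m` steps of the vertices of the subdivided clique. First the subdivision
vertices are contracted along the tries of the edges at each end, then the tries are contracted
into each other, and finally the remaining cycle is contracted. -/
def subdivisionLabel (n k B m : ℕ) : SubdividedCliqueVertex n k → (ℕ × ℕ) × ℕ
  | Sum.inl u => ((u / B ^ (m - k), 0), 0)
  | Sum.inr (e, i) => ((e.1.1 / B ^ droppedDigits k m (k - i), e.1.2 / B ^ droppedDigits k m (i + 1)),
      if (i : ℕ) + 1 ≤ m - 2 * k then 0 else i + 1)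

/-- The labels of the possible neighbours of a vertex with a given label. -/
def neighbourLabels (k B m : ℕ) (x : (ℕ × ℕ) × ℕ) : Finset ((ℕ × ℕ) × ℕ) :=
  (nearbyPrefixes B x.1.1 ×ˢ nearbyPrefixes B x.1.2 ∪
    (nearbyPrefixes B 0 ×ˢ nearbyPrefixes B x.1.1 ∪ {(x.1.1, 0), (x.1.2, 0)})) ×ˢ
    {0, x.2 - 1, x.2 + 1, 1, k, m - 2 * k + 1}

theorem card_neighbourLabels_le (k B m : ℕ) (x : (ℕ × ℕ) × ℕ) :
    (neighbourLabels k B m x).card ≤ (2 * (B + 2) ^ 2 + 2) * 6 := by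
  have h6 : ({0, x.2 - 1, x.2 + 1, 1, k, m - 2 * k + 1} : Finset ℕ).card ≤ 6 := Finset.card_le_six
  have h2 : ({(x.1.1, 0), (x.1.2, 0)} : Finset (ℕ × ℕ)).card ≤ 2 := Finset.card_le_two
  have hp : ∀ p q, (nearbyPrefixes B p ×ˢ nearbyPrefixes B q).card ≤ (B + 2) ^ 2 := by
    intro p q
    rw [Finset.card_product, sq]
    exact Nat.mul_le_mul (card_nearbyPrefixes_le _ _) (card_nearbyPrefixes_le _ _)
  unfold neighbourLabels
  rw [Finset.card_product]
  refine Nat.mul_le_mul ?_ h6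
  grw [Finset.card_union_le, Finset.card_union_le, h2, hp, hp]
  omega

/-- The labels before the `m`-th step of the vertices with a given label after it. -/
def previousLabels (k B m : ℕ) (x : (ℕ × ℕ) × ℕ) : Finset ((ℕ × ℕ) × ℕ) :=
  (nearbyPrefixes B x.1.1 ×ˢ nearbyPrefixes B x.1.2) ×ˢ {0, x.2, m + 1 - 2 * k}

theorem card_previousLabels_le (k B m : ℕ) (x : (ℕ × ℕ) × ℕ) :
    (previousLabels k B m x).card ≤ 3 * (B + 2) ^ 2 := by
  have h3 : ({0, x.2, m + 1 - 2 * k} : Finset ℕ).card ≤ 3 := Finset.card_le_three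
  unfold previousLabels
  rw [Finset.card_product, Finset.card_product, mul_comm 3, sq]
  exact Nat.mul_le_mul (Nat.mul_le_mul (card_nearbyPrefixes_le _ _) (card_nearbyPrefixes_le _ _)) h3

-- The chain of labels and the twin-width bound

section SubdividedClique

variable {n k B : ℕ}

/-- A step drops at most one digit of each name, and the only position it can newly send to `0` is
`m + 1 - 2 * k`. -/
theorem subdivisionLabel_mem_previousLabels (hB : 1 ≤ B) (m : ℕ) (x : SubdividedCliqueVertex n k) :
    subdivisionLabel n k B m x ∈ previousLabels k B m (subdivisionLabel n k B (m + 1) x) := by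
  rcases x with u | ⟨e, i⟩
  · simp only [subdivisionLabel, previousLabels, Finset.mem_product]
    refine ⟨⟨div_pow_mem_nearbyPrefixes hB _ ?_ ?_, self_mem_nearbyPrefixes _ _⟩, by simp⟩ <;> omega
  · simp only [subdivisionLabel, previousLabels, Finset.mem_product]
    refine ⟨⟨div_pow_mem_nearbyPrefixes hB _ ?_ ?_, div_pow_mem_nearbyPrefixes hB _ ?_ ?_⟩, ?_⟩
    · unfold droppedDigits; omega
    · unfold droppedDigits; omega
    · unfold droppedDigits; omega
    · unfold droppedDigits; omega
    · simp only [Finset.mem_insert, Finset.mem_singleton]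
      split_ifs <;> omega

theorem subdivisionLabel_succ_eq (hB : 1 ≤ B) (hn : n ≤ B ^ k) (m : ℕ)
    (x y : SubdividedCliqueVertex n k)
    (h : subdivisionLabel n k B m x = subdivisionLabel n k B m y) :
    subdivisionLabel n k B (m + 1) x = subdivisionLabel n k B (m + 1) y := by
  have hz : ∀ (z : Fin n) {s}, k ≤ s → (z : ℕ) / B ^ s = 0 := fun z s hs =>
    div_pow_eq_zero_of_lt hB (z.2.trans_le hn) hs
  have key : ∀ (u : Fin n) (e : CliqueEdge n) (i : Fin k),
      subdivisionLabel n k B m (Sum.inl u) = subdivisionLabel n k B m (Sum.inr (e, i)) →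
      subdivisionLabel n k B (m + 1) (Sum.inl u) =
        subdivisionLabel n k B (m + 1) (Sum.inr (e, i)) := by
    intro u e i h
    simp only [subdivisionLabel, Prod.mk.injEq] at h ⊢
    -- Branch vertices have position `0`, so the subdivision vertex has already been absorbed; then
    -- `m > 2 * k` and all digits are gone.
    have hi : (i : ℕ) + 1 ≤ m - 2 * k := by
      by_contra hc
      rw [if_neg hc] at h
      omega
    refine ⟨⟨?_, ?_⟩, ?_⟩
    · rw [hz _ (by omega), hz _ (by unfold droppedDigits; omega)]
    · rw [hz _ (by unfold droppedDigits; omega)]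
    · rw [if_pos (by omega)]
  rcases x with u | ⟨e, i⟩ <;> rcases y with v | ⟨f, j⟩
  · simp only [subdivisionLabel, Prod.mk.injEq, and_true] at h ⊢
    exact div_pow_eq_div_pow_of_le h (by omega)
  · exact key _ _ _ h
  · exact (key _ _ _ h.symm).symm
  · simp only [subdivisionLabel, Prod.mk.injEq] at h ⊢
    by_cases hm : 2 * k ≤ m
    · refine ⟨⟨?_, ?_⟩, ?_⟩
      · rw [hz _ (by unfold droppedDigits; omega), hz _ (by unfold droppedDigits; omega)]
      · rw [hz _ (by unfold droppedDigits; omega), hz _ (by unfold droppedDigits; omega)]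
      · have h3 := h.2
        split_ifs at h3 ⊢ <;> omega
    -- Before the cycle is contracted the label shows the position, so both vertices drop equally
    -- many digits.
    · rw [if_neg (by omega), if_neg (by omega)] at h
      have hij : (i : ℕ) = j := by omega
      rw [hij] at h ⊢
      refine ⟨⟨div_pow_eq_div_pow_of_le h.1.1 ?_, div_pow_eq_div_pow_of_le h.1.2 ?_⟩, rfl⟩ <;>
      · unfold droppedDigits; omega

theorem subdivisionLabel_zero_injective : Function.Injective (subdivisionLabel n k B 0) := by
  rintro (u | ⟨e, i⟩) (v | ⟨f, j⟩) h
  · simp only [subdivisionLabel, Prod.mk.injEq, and_true, Nat.zero_sub, pow_zero, Nat.div_one] at h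
    rw [Fin.ext h]
  · simp [subdivisionLabel] at h
  · simp [subdivisionLabel] at h
  · simp only [subdivisionLabel, Prod.mk.injEq, Nat.zero_sub, droppedDigits, Nat.zero_min,
      max_self, pow_zero, Nat.div_one] at h
    rw [if_neg (by omega), if_neg (by omega)] at h
    rw [Fin.ext (show (i : ℕ) = j by omega), Subtype.ext (Prod.ext (Fin.ext h.1.1) (Fin.ext h.1.2))]

theorem subdivisionLabel_three_mul (hB : 1 ≤ B) (hn : n ≤ B ^ k) (x : SubdividedCliqueVertex n k) :
    subdivisionLabel n k B (3 * k) x = ((0, 0), 0) := by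
  have hz : ∀ (z : Fin n) {s}, k ≤ s → (z : ℕ) / B ^ s = 0 := fun z s hs =>
    div_pow_eq_zero_of_lt hB (z.2.trans_le hn) hs
  rcases x with u | ⟨e, i⟩
  · simp only [subdivisionLabel]
    rw [hz _ (by omega)]
  · simp only [subdivisionLabel]
    rw [hz _ (by unfold droppedDigits; omega), hz _ (by unfold droppedDigits; omega),
      if_pos (by omega)]

/-- Along a path the numbers of dropped digits change by at most one per edge. Next to a branch
vertex its own name is cut exactly as in its label, while the name of the other end has at most one
digit left once `k ≤ m`; before that, a branch vertex may see many classes. -/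
theorem subdivisionLabel_mem_neighbourLabels (hB : 1 ≤ B) (hn : n ≤ B ^ k) {m : ℕ}
    {a b : SubdividedCliqueVertex n k} (h : (subdividedClique n k).Adj a b)
    (hm : k ≤ m ∨ a.isRight) :
    subdivisionLabel n k B m b ∈ neighbourLabels k B m (subdivisionLabel n k B m a) := by
  have hz : ∀ (z : Fin n) {s}, k ≤ s + 1 → (z : ℕ) / B ^ s ∈ nearbyPrefixes B 0 := fun z s hs =>
    div_pow_mem_nearbyPrefixes_zero hB (z.2.trans_le hn) hs
  have hk := one_le_of_subdividedClique_adj hn h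
  have hd : ∀ {t}, k ≤ t → droppedDigits k m t = m - k := fun ht => by
    unfold droppedDigits; omega
  rcases subdivisionStep_of_adj hk h with h | h
  · rcases h with ⟨e, i, hi⟩ | ⟨e, i, j, hij⟩ | ⟨e, i, hi⟩
    · have hm : k ≤ m := by simpa using hm
      simp only [subdivisionLabel, neighbourLabels, Finset.mem_product, Finset.mem_union]
      refine ⟨Or.inl ⟨?_, hz _ ?_⟩, ?_⟩
      · rw [hd (by omega)]
        exact self_mem_nearbyPrefixes _ _
      · unfold droppedDigits; omega
      · simp only [Finset.mem_insert, Finset.mem_singleton]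
        split_ifs <;> omega
    · simp only [subdivisionLabel, neighbourLabels, Finset.mem_product, Finset.mem_union]
      refine ⟨Or.inl ⟨div_pow_mem_nearbyPrefixes hB _ ?_ ?_,
        div_pow_mem_nearbyPrefixes hB _ ?_ ?_⟩, ?_⟩
      · unfold droppedDigits; omega
      · unfold droppedDigits; omega
      · unfold droppedDigits; omega
      · unfold droppedDigits; omega
      · simp only [Finset.mem_insert, Finset.mem_singleton]
        split_ifs <;> omega
    · simp only [subdivisionLabel, neighbourLabels, Finset.mem_product, Finset.mem_union]
      refine ⟨Or.inr (Or.inr ?_), by simp⟩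
      rw [hd (t := i + 1) (by omega)]
      simp
  · rcases h with ⟨e, i, hi⟩ | ⟨e, i, j, hij⟩ | ⟨e, i, hi⟩
    · simp only [subdivisionLabel, neighbourLabels, Finset.mem_product, Finset.mem_union]
      refine ⟨Or.inr (Or.inr ?_), by simp⟩
      rw [hd (t := k - i) (by omega)]
      simp
    · simp only [subdivisionLabel, neighbourLabels, Finset.mem_product, Finset.mem_union]
      refine ⟨Or.inl ⟨div_pow_mem_nearbyPrefixes hB _ ?_ ?_,
        div_pow_mem_nearbyPrefixes hB _ ?_ ?_⟩, ?_⟩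
      · unfold droppedDigits; omega
      · unfold droppedDigits; omega
      · unfold droppedDigits; omega
      · unfold droppedDigits; omega
      · simp only [Finset.mem_insert, Finset.mem_singleton]
        split_ifs <;> omega
    · have hm : k ≤ m := by simpa using hm
      simp only [subdivisionLabel, neighbourLabels, Finset.mem_product, Finset.mem_union]
      refine ⟨Or.inr (Or.inl ⟨hz _ ?_, ?_⟩), ?_⟩
      · unfold droppedDigits; omega
      · rw [hd (by omega)]
        exact self_mem_nearbyPrefixes _ _
      · simp only [Finset.mem_insert, Finset.mem_singleton]
        split_ifs <;> omega

theorem eq_of_subdivisionLabel_eq_inl {m : ℕ} (hm : m < k) {u : Fin n}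
    {c : SubdividedCliqueVertex n k}
    (h : subdivisionLabel n k B m c = subdivisionLabel n k B m (Sum.inl u)) : c = Sum.inl u := by
  rcases c with v | ⟨f, j⟩
  · simp only [subdivisionLabel, Prod.mk.injEq, and_true, Nat.sub_eq_zero_of_le hm.le, pow_zero,
      Nat.div_one] at h
    rw [Fin.ext h]
  · simp only [subdivisionLabel, Prod.mk.injEq] at h
    rw [if_neg (by omega)] at h
    omega

/-- As long as the branch vertices are not contracted, their neighbourhoods are unions of classes. -/
theorem subdividedClique_adj_inl_of_subdivisionLabel_eq {m : ℕ} (hm : m < k) {u : Fin n}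
    {b b' : SubdividedCliqueVertex n k} (h : (subdividedClique n k).Adj (Sum.inl u) b)
    (hb : subdivisionLabel n k B m b' = subdivisionLabel n k B m b) :
    (subdividedClique n k).Adj (Sum.inl u) b' := by
  have hd : ∀ {t}, k ≤ t → droppedDigits k m t = 0 := fun ht => by
    unfold droppedDigits; omega
  have key : ∀ (e : CliqueEdge n) (i : Fin k),
      subdivisionLabel n k B m b' = subdivisionLabel n k B m (Sum.inr (e, i)) →
      ∃ f : CliqueEdge n, b' = Sum.inr (f, i) ∧ ((i : ℕ) = 0 → f.1.1 = e.1.1) ∧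
        ((i : ℕ) + 1 = k → f.1.2 = e.1.2) := by
    intro e i h
    rcases b' with v | ⟨f, j⟩
    · have := eq_of_subdivisionLabel_eq_inl hm h.symm
      simp at this
    · simp only [subdivisionLabel, Prod.mk.injEq] at h
      rw [if_neg (by omega), if_neg (by omega)] at h
      obtain rfl : j = i := Fin.ext (by omega)
      refine ⟨f, rfl, fun hj => Fin.ext ?_, fun hj => Fin.ext ?_⟩
      · have := h.1.1
        rwa [hd (by omega), pow_zero, Nat.div_one, Nat.div_one] at this
      · have := h.1.2
        rwa [hd (by omega), pow_zero, Nat.div_one, Nat.div_one] at this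
  rcases subdivisionStep_of_adj (by omega) h with h | h
  · rcases h with ⟨e, i, hi⟩
    obtain ⟨f, rfl, hf, -⟩ := key e i hb
    rw [← hf hi]
    exact subdividedClique_adj_first f hi
  · rcases h with _ | _ | ⟨e, i, hi⟩
    obtain ⟨f, rfl, -, hf⟩ := key e i hb
    rw [← hf hi]
    exact subdividedClique_adj_last f hi

/-- If `n ≤ B ^ k`, then the twin-width of the `k`-subdivision of `K_n` is bounded by a polynomial
in `B`. -/
theorem twinWidth_subdividedClique_le (hB : 1 ≤ B) (hn1 : 1 ≤ n) (hn : n ≤ B ^ k) :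
    twinWidth (subdividedClique n k) ≤ 100 * (B + 2) ^ 4 := by
  have : Nonempty (SubdividedCliqueVertex n k) := ⟨Sum.inl ⟨0, hn1⟩⟩
  have h : HasContractionSequence (subdividedClique n k)
      (3 * (B + 2) ^ 2 * ((2 * (B + 2) ^ 2 + 2) * 6 + 1)) := by
    refine hasContractionSequence_of_labels _ (subdivisionLabel n k B) (3 * k) _ _
      subdivisionLabel_zero_injective
      (fun x y => by
        rw [subdivisionLabel_three_mul hB hn, subdivisionLabel_three_mul hB hn])
      (subdivisionLabel_succ_eq hB hn) ?_ ?_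
    · intro m x
      refine ⟨_, card_previousLabels_le k B m (subdivisionLabel n k B (m + 1) x), ?_⟩
      intro y hy
      rw [← hy]
      exact subdivisionLabel_mem_previousLabels hB m y
    · intro m x
      refine ⟨_, card_neighbourLabels_le k B m (subdivisionLabel n k B m x), ?_⟩
      intro a y b c e ha hb hab hc he hce
      rw [← hb, ← ha]
      apply subdivisionLabel_mem_neighbourLabels hB hn hab
      -- The remaining case is a branch vertex at a stage `m < k`: it is still a singleton class and
      -- has only black edges.
      by_contra! hcon
      obtain ⟨hmk, har⟩ := hcon
      rcases a with u | a
      · have hcu := eq_of_subdivisionLabel_eq_inl hmk (hc.trans ha.symm)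
        subst hcu
        exact hce (subdividedClique_adj_inl_of_subdivisionLabel_eq hmk hab (he.trans hb.symm))
      · simp at har
  -- With `z = (B + 2) ^ 2` the bound obtained is `36 * z ^ 2 + 39 * z`, and `z ≥ 4`.
  refine (Nat.sInf_le h).trans ?_
  have h4 : 4 ≤ (B + 2) ^ 2 := by nlinarith
  have : (B + 2) ^ 4 = (B + 2) ^ 2 * (B + 2) ^ 2 := by ring
  rw [this]
  generalize (B + 2) ^ 2 = z at *
  nlinarith

end SubdividedClique

-- Absence of `K_{2,2}`

section SubdividedClique

variable {n k : ℕ}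

theorem eq_cliquePathVertex_of_adj_inr (hk : 1 ≤ k) {e : CliqueEdge n} {i : Fin k}
    {b : SubdividedCliqueVertex n k} (h : (subdividedClique n k).Adj (Sum.inr (e, i)) b) :
    b = cliquePathVertex e i ∨ b = cliquePathVertex e (i + 2) := by
  rcases subdivisionStep_of_adj hk h with h | h
  · rcases h with _ | ⟨_, _, j, hij⟩ | ⟨_, _, hi⟩
    · right
      rw [← cliquePathVertex_succ, hij]
    · right
      rw [show (i : ℕ) + 2 = k + 1 by omega, cliquePathVertex_last]
  · rcases h with ⟨_, _, hi⟩ | ⟨_, j, _, hij⟩ | _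
    · left
      rw [hi, cliquePathVertex_zero]
    · left
      rw [hij, cliquePathVertex_succ]

theorem cliquePathVertex_eq_imp {e f : CliqueEdge n} {i j : ℕ}
    (h : (cliquePathVertex e i : SubdividedCliqueVertex n k) = cliquePathVertex f j) :
    e = f ∨ i = 0 ∨ k < i := by
  rcases i with _ | i
  · exact Or.inr (Or.inl rfl)
  · by_cases hi : i < k
    · left
      unfold cliquePathVertex at h
      split_ifs at h <;> simp_all
    · omega

theorem isRight_of_adj_inl (hk : 1 ≤ k) {u : Fin n} {b : SubdividedCliqueVertex n k}
    (h : (subdividedClique n k).Adj (Sum.inl u) b) : ∃ p, b = Sum.inr p := by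
  rcases subdivisionStep_of_adj hk h with h | h
  · rcases h with ⟨e, i, hi⟩
    exact ⟨_, rfl⟩
  · rcases h with _ | _ | ⟨e, i, hi⟩
    exact ⟨_, rfl⟩

/-- On one path the two neighbours determine the position. On different paths both common neighbours
would be branch vertices, which forces a single subdivision vertex per edge, that is `k = 1`. -/
theorem subdividedClique_not_two_common_neighbours_inr (hk : 2 ≤ k) {p q : CliqueEdge n × Fin k}
    {b b' : SubdividedCliqueVertex n k} (hpq : p ≠ q) (hb : b ≠ b')
    (h1 : (subdividedClique n k).Adj (Sum.inr p) b)
    (h2 : (subdividedClique n k).Adj (Sum.inr p) b')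
    (h3 : (subdividedClique n k).Adj (Sum.inr q) b)
    (h4 : (subdividedClique n k).Adj (Sum.inr q) b') : False := by
  obtain ⟨e, i⟩ := p
  obtain ⟨f, j⟩ := q
  have hef : e = f ∨ e ≠ f := em _
  have key : ∀ {s t s' t' : ℕ}, s ≤ k + 1 → s' ≤ k + 1 → t ≤ k + 1 → t' ≤ k + 1 →
      (s = i ∧ s' = i + 2 ∨ s = i + 2 ∧ s' = i) → (t = j ∧ t' = j + 2 ∨ t = j + 2 ∧ t' = j) →
      b = cliquePathVertex e s → b' = cliquePathVertex e s' →
      b = cliquePathVertex f t → b' = cliquePathVertex f t' → False := by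
    intro s t s' t' hs hs' ht ht' hss htt e1 e2 e3 e4
    have e5 := e1.symm.trans e3
    have e6 := e2.symm.trans e4
    rcases hef with rfl | hef
    · have e7 := cliquePathVertex_injOn e hs ht e5
      have e8 := cliquePathVertex_injOn e hs' ht' e6
      exact hpq (by rw [show i = j from Fin.ext (by omega)])
    · have e7 := (cliquePathVertex_eq_imp e5).resolve_left hef
      have e8 := (cliquePathVertex_eq_imp e6).resolve_left hef
      omega
  have hi := i.2
  have hj := j.2
  rcases eq_cliquePathVertex_of_adj_inr (by omega) h1 with e1 | e1 <;>
  rcases eq_cliquePathVertex_of_adj_inr (by omega) h2 with e2 | e2 <;>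
  rcases eq_cliquePathVertex_of_adj_inr (by omega) h3 with e3 | e3 <;>
  rcases eq_cliquePathVertex_of_adj_inr (by omega) h4 with e4 | e4 <;>
  first
  | exact hb (e1.trans e2.symm)
  | exact hb (e3.trans e4.symm)
  | exact key (by omega) (by omega) (by omega) (by omega) (by omega) (by omega) e1 e2 e3 e4

theorem subdividedClique_not_two_common_neighbours (hk : 2 ≤ k)
    {a a' b b' : SubdividedCliqueVertex n k} (ha : a ≠ a') (hb : b ≠ b')
    (h1 : (subdividedClique n k).Adj a b) (h2 : (subdividedClique n k).Adj a b')
    (h3 : (subdividedClique n k).Adj a' b) (h4 : (subdividedClique n k).Adj a' b') : False := by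
  have left : ∀ {u : Fin n} {a a' b b' : SubdividedCliqueVertex n k}, a = Sum.inl u → a ≠ a' →
      b ≠ b' → (subdividedClique n k).Adj a b → (subdividedClique n k).Adj a b' →
      (subdividedClique n k).Adj a' b → (subdividedClique n k).Adj a' b' → False := by
    rintro u a a' b b' rfl ha hb h1 h2 h3 h4
    obtain ⟨p, rfl⟩ := isRight_of_adj_inl (by omega) h1
    obtain ⟨q, rfl⟩ := isRight_of_adj_inl (by omega) h2
    -- All neighbours of a branch vertex are subdivision vertices, so the two sides exchange roles.
    exact subdividedClique_not_two_common_neighbours_inr hk (fun h => hb (congrArg _ h)) ha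
      h1.symm h3.symm h2.symm h4.symm
  rcases a with u | p
  · exact left rfl ha hb h1 h2 h3 h4
  · rcases a' with u | q
    · exact left rfl ha.symm hb h3 h4 h1 h2
    · exact subdividedClique_not_two_common_neighbours_inr hk (fun h => ha (congrArg _ h)) hb
        h1 h2 h3 h4

theorem subdividedClique_free (hk : 2 ≤ k) :
    (completeBipartiteGraph (Fin 2) (Fin 2)).Free (subdividedClique n k) := by
  rintro ⟨f⟩
  have hadj : ∀ i j : Fin 2, (subdividedClique n k).Adj (f (Sum.inl i)) (f (Sum.inr j)) :=
    fun i j => f.toHom.map_adj (by simp)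
  exact subdividedClique_not_two_common_neighbours hk
    (f.injective.ne (show (Sum.inl 0 : Fin 2 ⊕ Fin 2) ≠ Sum.inl 1 by simp))
    (f.injective.ne (show (Sum.inr 0 : Fin 2 ⊕ Fin 2) ≠ Sum.inr 1 by simp))
    (hadj 0 0) (hadj 0 1) (hadj 1 0) (hadj 1 1)

end SubdividedClique

-- Admissibility

section Admissibility

variable {V : Type}

/-- The ends of the paths are distinct, because a shared one would be `v`, which is not before
itself. Thus the supremum in `backconnectivity` is over a bounded set and not a default value. -/
theorem HasBackPaths.le_card [Finite V] {G : SimpleGraph V} {r : ℕ} {L : LinearOrder V} {v : V}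
    {m : ℕ} (h : HasBackPaths G r L v m) : m ≤ Nat.card V := by
  obtain ⟨u, p, hp, hd⟩ := h
  have hinj : Function.Injective u := by
    intro i j hij
    by_contra hne
    have := hd i j hne (u i) (p i).end_mem_support
      (by rw [hij]; exact (p j).end_mem_support)
    have hlt := (hp i).2.2
    rw [this] at hlt
    exact lt_irrefl v hlt
  simpa using Nat.card_le_card_of_injective u hinj

theorem le_backconnectivity [Finite V] {G : SimpleGraph V} {r : ℕ} {L : LinearOrder V} {v : V}
    {m : ℕ} (h : HasBackPaths G r L v m) : m ≤ backconnectivity G r L v :=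
  le_csSup ⟨Nat.card V, fun _ hm => HasBackPaths.le_card hm⟩ h

theorem le_admissibility [Finite V] {G : SimpleGraph V} {r m : ℕ}
    (h : ∀ L : LinearOrder V, ∃ v, HasBackPaths G r L v m) : m ≤ admissibility G r := by
  classical
  -- An infimum over no orders would be `0`.
  have : Nonempty (LinearOrder V) := ⟨linearOrderOfSTO WellOrderingRel⟩
  refine le_ciInf fun L => ?_
  obtain ⟨v, hv⟩ := h L
  exact (le_backconnectivity hv).trans
    (le_ciSup (f := fun v => backconnectivity G r L v) (Set.toFinite _).bddAbove v)

theorem exists_forall_ne_lt {ι : Type*} [Finite ι] [Nonempty ι] (L : LinearOrder V) {f : ι → V}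
    (hf : Function.Injective f) : ∃ i, ∀ j, j ≠ i → L.lt (f j) (f i) := by
  obtain ⟨i, hi⟩ := Finite.exists_max f
  exact ⟨i, fun j hj => lt_of_le_of_ne (hi j) (hf.ne hj)⟩

theorem exists_walk_support_eq_map_range {G : SimpleGraph V} (f : ℕ → V) (m : ℕ)
    (h : ∀ i < m, G.Adj (f i) (f (i + 1))) :
    ∃ p : G.Walk (f 0) (f m), p.support = (List.range (m + 1)).map f := by
  induction m with
  | zero => exact ⟨.nil, by simp⟩
  | succ m ih =>
    obtain ⟨p, hp⟩ := ih fun i hi => h i (by omega)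
    refine ⟨p.concat (h m (by omega)), ?_⟩
    rw [Walk.support_concat, hp, List.range_succ (n := m + 1), List.map_append]
    simp

end Admissibility

section SubdividedClique

variable {n k : ℕ}

theorem exists_path_subdividedClique {u v : Fin n} {e : CliqueEdge n}
    (he : e.1 = (u, v) ∨ e.1 = (v, u)) :
    ∃ p : (subdividedClique n k).Walk (Sum.inl u) (Sum.inl v), p.IsPath ∧ p.length = k + 1 ∧
      ∀ w ∈ p.support, ∃ j ≤ k + 1, w = cliquePathVertex e j := by
  obtain ⟨g, hg0, hgl, hadj, hinj, hrange⟩ : ∃ g : ℕ → SubdividedCliqueVertex n k,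
      g 0 = Sum.inl u ∧ g (k + 1) = Sum.inl v ∧
      (∀ i < k + 1, (subdividedClique n k).Adj (g i) (g (i + 1))) ∧
      (∀ i ≤ k + 1, ∀ j ≤ k + 1, g i = g j → i = j) ∧
      (∀ i ≤ k + 1, ∃ j ≤ k + 1, g i = cliquePathVertex e j) := by
    rcases he with he | he
    · refine ⟨cliquePathVertex e, ?_, ?_, fun i hi => subdividedClique_adj_succ e (by omega),
        fun i hi j hj => cliquePathVertex_injOn e hi hj, fun i hi => ⟨i, hi, rfl⟩⟩
      · rw [cliquePathVertex_zero, he]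
      · rw [cliquePathVertex_last, he]
    · refine ⟨fun i => cliquePathVertex e (k + 1 - i), ?_, ?_, fun i hi => ?_,
        fun i hi j hj h => ?_, fun i hi => ⟨k + 1 - i, by omega, rfl⟩⟩
      · simp only [Nat.sub_zero]
        rw [cliquePathVertex_last, he]
      · simp only [Nat.sub_self]
        rw [cliquePathVertex_zero, he]
      · have := subdividedClique_adj_succ (k := k) e (j := k - i) (by omega)
        rw [show k - i + 1 = k + 1 - i by omega] at this
        simpa only [Nat.add_sub_add_right] using this.symm
      · have := cliquePathVertex_injOn e (by omega) (by omega) h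
        omega
  obtain ⟨p, hp⟩ := exists_walk_support_eq_map_range g (k + 1) hadj
  rw [← hg0, ← hgl]
  refine ⟨p, Walk.IsPath.mk' ?_, ?_, ?_⟩
  · rw [hp]
    refine List.Nodup.map_on ?_ List.nodup_range
    intro i hi j hj
    exact hinj i (by simpa [Nat.lt_succ_iff] using hi) j (by simpa [Nat.lt_succ_iff] using hj)
  · have := congrArg List.length hp
    rw [Walk.length_support, List.length_map, List.length_range] at this
    omega
  · intro w hw
    rw [hp] at hw
    obtain ⟨i, hi, rfl⟩ := List.mem_map.1 hw
    exact hrange i (by simpa [Nat.lt_succ_iff] using hi)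

/-- The branch vertex that is last in `L` among the branch vertices is joined to each of the others
by the path replacing their common edge. -/
theorem le_admissibility_subdividedClique (hn : 1 ≤ n) :
    n - 1 ≤ admissibility (subdividedClique n k) (k + 1) := by
  apply le_admissibility
  intro L
  have : Nonempty (Fin n) := ⟨⟨0, hn⟩⟩
  obtain ⟨v, hv⟩ := exists_forall_ne_lt L
    (Sum.inl_injective : Function.Injective (Sum.inl : Fin n → SubdividedCliqueVertex n k))
  obtain ⟨σ⟩ : Nonempty (Fin (n - 1) ≃ {u : Fin n // u ≠ v}) := by
    rw [← Fintype.card_eq]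
    simp [Fintype.card_subtype_compl]
  have hedge : ∀ i, ∃ e : CliqueEdge n, e.1 = (v, (σ i : Fin n)) ∨ e.1 = ((σ i : Fin n), v) := by
    intro i
    rcases lt_or_gt_of_ne (σ i).2 with h | h
    · exact ⟨⟨(_, _), h⟩, Or.inr rfl⟩
    · exact ⟨⟨(_, _), h⟩, Or.inl rfl⟩
  choose e he using hedge
  choose p hp using fun i => exists_path_subdividedClique (k := k) (he i)
  refine ⟨Sum.inl v, fun i => Sum.inl (σ i), p,
    fun i => ⟨(hp i).1, (hp i).2.1.le, hv _ (σ i).2⟩, ?_⟩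
  intro i j hij w hwi hwj
  have hσ : (σ i : Fin n) ≠ σ j := fun h => hij (σ.injective (Subtype.ext h))
  have hne : e i ≠ e j := by
    intro h
    have h1 := he i
    have h2 := he j
    rw [h] at h1
    have := (σ i).2
    have := (σ j).2
    rcases h1 with h1 | h1 <;> rcases h2 with h2 | h2 <;>
    · have h3 := h1.symm.trans h2
      simp only [Prod.mk.injEq] at h3
      grind
  -- Paths of different edges can meet only at their ends, and two of these paths have only `v` as a
  -- common end.
  have hends : ∀ i : Fin (n - 1), ∀ t, t ≤ k + 1 → (t = 0 ∨ k < t) →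
      (cliquePathVertex (e i) t : SubdividedCliqueVertex n k) = Sum.inl v ∨
      (cliquePathVertex (e i) t : SubdividedCliqueVertex n k) = Sum.inl (σ i : Fin n) := by
    intro i t ht h
    rcases h with rfl | h
    · rw [cliquePathVertex_zero]
      rcases he i with h | h <;> simp [h]
    · obtain rfl : t = k + 1 := by omega
      rw [cliquePathVertex_last]
      rcases he i with h | h <;> simp [h]
  obtain ⟨s, hs, rfl⟩ := (hp i).2.2 w hwi
  obtain ⟨t, ht, hst⟩ := (hp j).2.2 _ hwj
  have h1 := hends i s hs ((cliquePathVertex_eq_imp hst).resolve_left hne)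
  have h2 := hends j t ht ((cliquePathVertex_eq_imp hst.symm).resolve_left hne.symm)
  rw [← hst] at h2
  rcases h1 with h1 | h1
  · exact h1
  · rcases h2 with h2 | h2
    · exact h2
    · exact (hσ (Sum.inl_injective (h1.symm.trans h2))).elim

end SubdividedClique

-- Numerical estimates and the theorem

theorem le_two_rpow_self (x : ℝ) : x ≤ (2 : ℝ) ^ x := by
  have h1 := Real.add_one_le_exp (x * Real.log 2)
  rw [Real.rpow_def_of_pos (by norm_num), mul_comm]
  have hlog := Real.log_two_gt_d9
  rcases le_total x 0 with hx | hx
  · exact hx.trans (Real.exp_pos _).le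
  · have h2 := Real.add_one_le_exp (x * Real.log 2 - 1)
    rw [Real.exp_sub, le_div_iff₀ (Real.exp_pos 1)] at h2
    have he := Real.exp_one_gt_d9
    have : 0 ≤ x * Real.log 2 := by positivity
    nlinarith

/-- The innermost power already suffices: `B + 2 ≤ 4 * 2 ^ (2 * c)`, and `100 * 4 ^ 4 = 25600 ≤ 2 ^
15`. -/
theorem polynomial_le_two_rpow_two_rpow_two_rpow {c : ℝ} (hc : 0 ≤ c) {B : ℕ}
    (hB : (B : ℝ) ≤ Real.exp c + 1) :
    ((100 * (B + 2) ^ 4 : ℕ) : ℝ) ≤ (2 : ℝ) ^ ((2 : ℝ) ^ ((2 : ℝ) ^ (8 * c + 15))) := by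
  refine le_trans ?_ ((le_two_rpow_self _).trans (le_two_rpow_self _))
  have h1 : 1 ≤ Real.exp c := Real.one_le_exp hc
  have h2 : Real.exp c ≤ (2 : ℝ) ^ (2 * c) := by
    rw [Real.rpow_def_of_pos (by norm_num)]
    apply Real.exp_le_exp.2
    have := Real.log_two_gt_d9
    nlinarith
  have h3 : (2 : ℝ) ^ (8 * c + 15) = 32768 * ((2 : ℝ) ^ (2 * c)) ^ 4 := by
    rw [Real.rpow_add (by norm_num), ← Real.rpow_mul_natCast (by norm_num), mul_comm]
    norm_num
    ring_nf
  rw [h3]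
  push_cast
  calc (100 : ℝ) * (B + 2) ^ 4 ≤ 100 * (4 * (2 : ℝ) ^ (2 * c)) ^ 4 := by
        gcongr
        linarith
    _ = 25600 * ((2 : ℝ) ^ (2 * c)) ^ 4 := by ring
    _ ≤ _ := by gcongr; norm_num

theorem mainTheorem6 :
    ∃ f : ℝ → ℝ, IsTripleExponential f ∧
      (∀ c : ℝ, 0 < c → ∀ n k : ℕ, 1 ≤ n → Real.log n / c ≤ k →
        (twinWidth (subdividedClique n k) : ℝ) ≤ f c) ∧
      ∀ d r : ℕ, 1 ≤ d → 4 ≤ r →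
        (∃ (V : Type) (_ : Finite V) (G : SimpleGraph V),
          (completeBipartiteGraph (Fin 2) (Fin 2)).Free G ∧
          (twinWidth G : ℝ) ≤ f (2 * Real.log d) ∧
          d ^ (2 * (r - 1)) ≤ admissibility G r) ∧
        ((completeBipartiteGraph (Fin 2) (Fin 2)).Free
            (subdividedClique (d ^ (2 * (r - 1))) (r - 1)) ∧
          (twinWidth (subdividedClique (d ^ (2 * (r - 1))) (r - 1)) : ℝ) ≤
            f (2 * Real.log d) ∧
          d ^ (2 * (r - 1)) ≤
            admissibility (subdividedClique (d ^ (2 * (r - 1))) (r - 1)) r + 1) := by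
  refine ⟨fun c => (2 : ℝ) ^ ((2 : ℝ) ^ ((2 : ℝ) ^ (8 * c + 15))),
    ⟨8, 15, 8, 15, by norm_num, by norm_num, fun c _ => ⟨le_rfl, le_rfl⟩⟩, ?_, ?_⟩
  · intro c hc n k hn hk
    have hB : 1 ≤ ⌈Real.exp c⌉₊ := Nat.one_le_ceil_iff.2 (Real.exp_pos c)
    have hle : n ≤ ⌈Real.exp c⌉₊ ^ k := by
      have hn0 : (0 : ℝ) < n := by exact_mod_cast hn
      have h1 : Real.log n ≤ k * c := (div_le_iff₀ hc).1 hk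
      have h2 : (n : ℝ) ≤ Real.exp c ^ k := by
        rw [← Real.exp_nat_mul]
        exact (Real.log_le_iff_le_exp hn0).1 h1
      have h3 : Real.exp c ^ k ≤ (⌈Real.exp c⌉₊ : ℝ) ^ k :=
        pow_le_pow_left₀ (Real.exp_pos c).le (Nat.le_ceil _) k
      exact_mod_cast h2.trans h3
    exact (Nat.cast_le.2 (twinWidth_subdividedClique_le hB hn hle)).trans
      (polynomial_le_two_rpow_two_rpow_two_rpow hc.le (Nat.ceil_lt_add_one (Real.exp_pos c).le).le)
  · intro d r hd hr
    obtain ⟨k, rfl⟩ : ∃ k, r = k + 1 := ⟨r - 1, by omega⟩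
    rw [Nat.add_sub_cancel]
    have hd0 : (0 : ℝ) < d := by exact_mod_cast hd
    have hc : 0 ≤ 2 * Real.log d := by
      have := Real.log_nonneg (show (1 : ℝ) ≤ d by exact_mod_cast hd)
      positivity
    have hexp : Real.exp (2 * Real.log d) = (d : ℝ) ^ 2 := by
      rw [two_mul, Real.exp_add, Real.exp_log hd0, sq]
    -- The base `B = d ^ 2 + 1 = exp (2 * log d) + 1` also covers `d = 1`, where `c = 0`, and leaves
    -- room for one more branch vertex than `d ^ (2 * k)`.
    have hbound : ∀ n, 1 ≤ n → n ≤ (d ^ 2 + 1) ^ k →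
        (twinWidth (subdividedClique n k) : ℝ) ≤
          (2 : ℝ) ^ ((2 : ℝ) ^ ((2 : ℝ) ^ (8 * (2 * Real.log d) + 15))) := fun n hn1 hn =>
      (Nat.cast_le.2 (twinWidth_subdividedClique_le (by omega) hn1 hn)).trans
        (polynomial_le_two_rpow_two_rpow_two_rpow hc (by rw [hexp]; push_cast; exact le_rfl))
    have hpow : d ^ (2 * k) < (d ^ 2 + 1) ^ k := by
      rw [pow_mul]
      exact Nat.pow_lt_pow_left (Nat.lt_succ_self _) (by omega)
    have hpos : 1 ≤ d ^ (2 * k) := Nat.one_le_pow _ _ hd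
    -- The additional branch vertex makes up for the `n - 1` in the admissibility bound.
    refine ⟨⟨_, inferInstance, subdividedClique (d ^ (2 * k) + 1) k,
      subdividedClique_free (by omega), hbound _ (by omega) hpow,
      le_admissibility_subdividedClique (n := d ^ (2 * k) + 1) (by omega)⟩,
      subdividedClique_free (by omega), hbound _ hpos hpow.le, ?_⟩
    have := le_admissibility_subdividedClique (k := k) hpos
    omega
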